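/- Let $I=[0,1]$ and let $\mathbb E^2$ be the Euclidean plane. For every $c>0$ there is a continuous function $\rho: I^2\to[1,1+c]$ such that there is no biLipschitz map $f: I^2\to\mathbb E^2$ (that is, no map with $L^{-1}|x-y|\le|f(x)-f(y)|\le L|x-y|$ for all $x,y\in I^2$, for some $L\ge 1$) with $$\operatorname{Jac}(f):=\det(Df)=\rho\quad\text{almost everywhere on } I^2 .$$ Moreover, $\rho$ can be chosen so that there is also no Lipschitz homeomorphism $f$ from $I^2$ onto its image $f(I^2)\subset\mathbb E^2$ with $\det(Df)=\rho$ almost everywhere on $I^2$ (no Lipschitz condition is imposed on the inverse of $f$). -/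

import Mathlib

open MeasureTheory Set
open scoped NNReal

/-- The Euclidean plane. -/
abbrev Plane : Type := EuclideanSpace ℝ (Fin 2)

/-- The closed unit square `[0,1]²` in the Euclidean plane. -/
def unitSquare : Set Plane := {x | ∀ i, x i ∈ Icc (0 : ℝ) 1}

/-- `f`, regarded as a map `s → Plane`, is biLipschitz: it is `L`-biLipschitz for some `L ≥ 1`. -/
def IsBiLipschitzOn (f : Plane → Plane) (s : Set Plane) : Prop :=
  ∃ L : ℝ, 1 ≤ L ∧ ∀ x ∈ s, ∀ y ∈ s,
    L⁻¹ * dist x y ≤ dist (f x) (f y) ∧ dist (f x) (f y) ≤ L * dist x y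

/-- `f`, regarded as a map `s → Plane`, is a Lipschitz homeomorphism: it is Lipschitz, and a
homeomorphism from `s` onto its image (no Lipschitz condition on the inverse). -/
def IsLipschitzHomeoOn (f : Plane → Plane) (s : Set Plane) : Prop :=
  (∃ K : ℝ≥0, LipschitzOnWith K f s) ∧ Topology.IsEmbedding (s.domRestrict f)

/-- `f`, regarded as a map `s → Plane`, satisfies `det (Df) = ρ` almost everywhere on `s` (with
respect to Lebesgue measure): at almost every `x ∈ s`, `f` is differentiable within `s`, with a
derivative of determinant `ρ x`. -/
def HasJacobianAEOn (f : Plane → Plane) (ρ : Plane → ℝ) (s : Set Plane) : Prop :=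
  ∀ᵐ x ∂(volume.restrict s), ∃ f' : Plane →L[ℝ] Plane,
    HasFDerivWithinAt f f' s x ∧ f'.det = ρ x

/-! The density constructed is not the Jacobian of any Lipschitz map, injective or not, which
settles both claims at once. The mechanism is a stretch increment. Let a `K`-Lipschitz map `f`
stretch a horizontal segment of length `d` by a factor at least `A`, and let the density on a thin
nearby strip oscillate like a sine in the first coordinate, with half-period `r` much smaller than
`d`. Suppose no horizontal segment of length `r` in the strip is stretched by `B = A + τ ^ 2`. The
total stretch then leaves almost no slack, so the increments `f (z + (r, 0)) - f z` are close in
`L¹` to one fixed vector (`integral_norm_shift_sub_le`): shifting the argument by `r` nearly amounts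
to translating the image. Integrals of the Jacobian against a Lipschitz function barely change under
such a perturbation (`abs_integral_mul_jacobian_sub_le`), whereas the shift by a half-period
reverses the sine, which a test function detects (`abs_integral_mul_shift_sub_ge`). This
contradiction gives a gain `τ ^ 2` depending only on `c` and `K` (`exists_stretch_gain`).

The place where `f` stretches is unknown, so oscillating strips are inserted at many heights. Their
total area is small, and the conclusion of each stage is stable under changing the density on a
small set, so stages can be superposed (`ForcesStretch.add`). Finitely many stages push the stretch
beyond `K`, which is absurd. Rescaled densities for `K = 1, 2, 3, …`, with geometrically decaying
amplitudes, are then placed over disjoint squares accumulating at the origin. -/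

open Filter Topology

/-! ### Discrete areas and weak continuity of the Jacobian. -/

/-- The standard area form on the plane. -/
def wedge (u v : Plane) : ℝ := u 0 * v 1 - u 1 * v 0

theorem abs_wedge_le (u v : Plane) : |wedge u v| ≤ ‖u‖ * ‖v‖ := by
  refine abs_le_of_sq_le_sq ?_ (by positivity)
  rw [mul_pow, EuclideanSpace.real_norm_sq_eq, EuclideanSpace.real_norm_sq_eq]
  simp only [Fin.sum_univ_two, wedge]
  nlinarith [sq_nonneg (u 0 * v 0 + u 1 * v 1)]

theorem Continuous.wedge {X : Type*} [TopologicalSpace X] {f g : X → Plane}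
    (hf : Continuous f) (hg : Continuous g) : Continuous fun x => wedge (f x) (g x) := by
  unfold _root_.wedge
  fun_prop

theorem Filter.Tendsto.wedge {X : Type*} {l : Filter X} {f g : X → Plane} {u v : Plane}
    (hf : Tendsto f l (𝓝 u)) (hg : Tendsto g l (𝓝 v)) :
    Tendsto (fun x => wedge (f x) (g x)) l (𝓝 (wedge u v)) := by
  have h : Continuous fun p : Plane × Plane => _root_.wedge p.1 p.2 :=
    continuous_fst.wedge continuous_snd
  exact (h.tendsto (u, v)).comp (hf.prodMk_nhds hg)

theorem wedge_smul_smul (a b : ℝ) (u v : Plane) : wedge (a • u) (b • v) = a * b * wedge u v := by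
  simp [wedge]; ring

/-- The signed area of the quadrilateral spanned by the images under `f` of the corners of the
square of side `s` with lower left corner `z`. -/
noncomputable def quadArea (f : ℝ × ℝ → Plane) (s : ℝ) (z : ℝ × ℝ) : ℝ :=
  wedge (f (z + (s, s)) - f z) (f (z + (0, s)) - f (z + (s, 0))) / 2

/-- The change, up to a coboundary, of the area swept by the image of the edge `[z, z + e]` when
`f` is replaced by `f + w`. -/
noncomputable def edgeArea (f w : ℝ × ℝ → Plane) (e z : ℝ × ℝ) : ℝ :=
  (wedge (w z + w (z + e)) (f (z + e) - f z) + wedge (w z) (w (z + e) - w z)) / 2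

/-- The change of area is a discrete divergence: it is a signed sum over the four edges, in which
opposite edges enter as translates of each other. This allows summation by parts without
differentiating Lipschitz maps twice. -/
theorem quadArea_add_sub (f w : ℝ × ℝ → Plane) (s : ℝ) (z : ℝ × ℝ) :
    quadArea (f + w) s z - quadArea f s z =
      (edgeArea f w (s, 0) z - edgeArea f w (s, 0) (z + (0, s))) +
      (edgeArea f w (0, s) (z + (s, 0)) - edgeArea f w (0, s) z) := by
  have h1 : z + (0, s) + (s, 0) = z + (s, s) := by ext <;> simp
  have h2 : z + (s, 0) + (0, s) = z + (s, s) := by ext <;> simp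
  simp only [quadArea, edgeArea, h1, h2, wedge, Pi.add_apply, PiLp.add_apply, PiLp.sub_apply]
  ring

theorem continuous_quadArea {f : ℝ × ℝ → Plane} (hf : Continuous f) (s : ℝ) :
    Continuous (quadArea f s) := by
  unfold quadArea
  exact (Continuous.wedge (by fun_prop) (by fun_prop)).div_const 2

theorem continuous_edgeArea {f w : ℝ × ℝ → Plane} (hf : Continuous f) (hw : Continuous w)
    (e : ℝ × ℝ) : Continuous (edgeArea f w e) := by
  unfold edgeArea
  exact ((Continuous.wedge (by fun_prop) (by fun_prop)).add
    (Continuous.wedge (by fun_prop) (by fun_prop))).div_const 2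

theorem norm_horizontal {s : ℝ} (hs : 0 ≤ s) : ‖((s, 0) : ℝ × ℝ)‖ = s := by
  simp [Prod.norm_def, abs_of_nonneg hs, hs]

theorem norm_vertical {s : ℝ} (hs : 0 ≤ s) : ‖((0, s) : ℝ × ℝ)‖ = s := by
  simp [Prod.norm_def, abs_of_nonneg hs, hs]

theorem LipschitzWith.norm_add_sub_le {K : ℝ≥0} {f : ℝ × ℝ → Plane} (hf : LipschitzWith K f)
    (z e : ℝ × ℝ) : ‖f (z + e) - f z‖ ≤ K * ‖e‖ := by
  simpa using hf.norm_sub_le (z + e) z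

theorem abs_quadArea_le {K : ℝ≥0} {f : ℝ × ℝ → Plane} (hf : LipschitzWith K f) {s : ℝ}
    (hs : 0 ≤ s) (z : ℝ × ℝ) : |quadArea f s z| ≤ K ^ 2 * s ^ 2 := by
  have h1 : ‖f (z + (s, s)) - f z‖ ≤ K * s := by
    simpa [Prod.norm_def, abs_of_nonneg hs] using hf.norm_add_sub_le z (s, s)
  have h2 : ‖f (z + (0, s)) - f (z + (s, 0))‖ ≤ K * s := by
    have h : z + (0, s) - (z + (s, 0)) = (-s, s) := by ext <;> simp
    have h' := hf.norm_sub_le (z + (0, s)) (z + (s, 0))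
    rw [h] at h'
    simpa [Prod.norm_def, abs_of_nonneg hs] using h'
  have h3 := abs_wedge_le (f (z + (s, s)) - f z) (f (z + (0, s)) - f (z + (s, 0)))
  have h4 := mul_le_mul h1 h2 (norm_nonneg _) (by positivity)
  rw [quadArea, abs_div, abs_two]
  nlinarith [sq_nonneg (K * s : ℝ)]

/-- Every term of first order in `‖e‖` carries a factor `‖w z‖`. The quadratic remainder, with one
more factor `s` from summation by parts, still vanishes after division by `s ^ 2`. -/
theorem abs_edgeArea_le {K : ℝ≥0} {f w : ℝ × ℝ → Plane} (hf : LipschitzWith K f)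
    (hw : LipschitzWith (2 * K) w) (e z : ℝ × ℝ) :
    |edgeArea f w e z| ≤ 2 * K * ‖e‖ * ‖w z‖ + K ^ 2 * ‖e‖ ^ 2 := by
  have h1 := hf.norm_add_sub_le z e
  have h2 : ‖w (z + e) - w z‖ ≤ 2 * K * ‖e‖ := by simpa using hw.norm_add_sub_le z e
  have h3 : ‖w z + w (z + e)‖ ≤ 2 * ‖w z‖ + 2 * K * ‖e‖ := by
    calc ‖w z + w (z + e)‖ = ‖w z + w z + (w (z + e) - w z)‖ := by congr 1; abel
      _ ≤ ‖w z‖ + ‖w z‖ + ‖w (z + e) - w z‖ := norm_add₃_le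
      _ ≤ _ := by linarith
  have h4 := (abs_wedge_le (w z + w (z + e)) (f (z + e) - f z)).trans
    (mul_le_mul h3 h1 (norm_nonneg _) (by positivity))
  have h5 := (abs_wedge_le (w z) (w (z + e) - w z)).trans
    (mul_le_mul_of_nonneg_left h2 (norm_nonneg _))
  rw [edgeArea, abs_div, abs_two, div_le_iff₀ two_pos]
  refine (abs_add_le _ _).trans ?_
  nlinarith

theorem tendsto_quadArea_div_sq {f : ℝ × ℝ → Plane} {f' : ℝ × ℝ →L[ℝ] Plane} {z : ℝ × ℝ}
    (hf : HasFDerivAt f f' z) :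
    Tendsto (fun s : ℝ => s⁻¹ ^ 2 * quadArea f s z) (𝓝[>] 0)
      (𝓝 (wedge (f' (1, 0)) (f' (0, 1)))) := by
  have key (v : ℝ × ℝ) : Tendsto (fun s : ℝ => s⁻¹ • (f (z + s • v) - f z)) (𝓝[>] 0)
      (𝓝 (f' v)) := (hf.hasLineDerivAt v).tendsto_slope_zero_right
  have h := ((key (1, 1)).wedge ((key (0, 1)).sub (key (1, 0)))).div_const 2
  have e11 : f' (1, 1) = f' (1, 0) + f' (0, 1) := by rw [← map_add]; simp
  convert h using 2 with s
  · rw [← smul_sub, wedge_smul_smul, quadArea]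
    simp only [Prod.smul_mk, smul_eq_mul, mul_one, mul_zero, sub_sub_sub_cancel_right]
    ring
  · rw [e11]
    simp only [wedge, PiLp.add_apply, PiLp.sub_apply]
    ring

/-- Dominated convergence: the Lipschitz bound controls the normalized areas by `K ^ 2` uniformly in
`s`. -/
theorem tendsto_integral_mul_quadArea {K : ℝ≥0} {f : ℝ × ℝ → Plane} (hf : LipschitzWith K f)
    {φ J : ℝ × ℝ → ℝ} (hφ : Continuous φ) (hφc : HasCompactSupport φ)
    (hJ : ∀ᵐ z, φ z ≠ 0 → ∃ f' : ℝ × ℝ →L[ℝ] Plane,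
      HasFDerivAt f f' z ∧ wedge (f' (1, 0)) (f' (0, 1)) = J z) :
    Tendsto (fun s : ℝ => ∫ z, φ z * (s⁻¹ ^ 2 * quadArea f s z)) (𝓝[>] 0)
      (𝓝 (∫ z, φ z * J z)) := by
  refine tendsto_integral_filter_of_dominated_convergence (fun z => |φ z| * K ^ 2) ?_ ?_ ?_ ?_
  · refine Eventually.of_forall fun s => Continuous.aestronglyMeasurable ?_
    exact hφ.mul (continuous_const.mul (continuous_quadArea hf.continuous s))
  · filter_upwards [self_mem_nhdsWithin] with s hs
    refine Eventually.of_forall fun z => ?_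
    have hs : 0 < s := hs
    rw [norm_mul, Real.norm_eq_abs, Real.norm_eq_abs, abs_mul,
      abs_of_nonneg (by positivity : 0 ≤ s⁻¹ ^ 2)]
    refine mul_le_mul_of_nonneg_left ?_ (abs_nonneg _)
    have := mul_le_mul_of_nonneg_left (abs_quadArea_le hf hs.le z)
      (by positivity : 0 ≤ s⁻¹ ^ 2)
    refine this.trans (le_of_eq ?_)
    field_simp
  · exact ((hφ.integrable_of_hasCompactSupport hφc).abs).mul_const _
  · filter_upwards [hJ] with z hz
    by_cases h0 : φ z = 0
    · simp [h0]
    · obtain ⟨f', hf', hJz⟩ := hz h0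
      rw [← hJz]
      exact (tendsto_quadArea_div_sq hf').const_mul _

/-- Summation by parts: translation invariance moves the shift from `E` to `φ`, whose Lipschitz
constant supplies the factor `‖e‖`. -/
theorem abs_integral_mul_sub_translate_le {Λ : ℝ≥0} {φ E : ℝ × ℝ → ℝ} (hφ : LipschitzWith Λ φ)
    (hφc : HasCompactSupport φ) (hE : Continuous E) {R : Set (ℝ × ℝ)} (hR : IsCompact R)
    {e : ℝ × ℝ} (hsupp : ∀ z ∉ R, φ z = 0 ∧ φ (z - e) = 0) :
    |∫ z, φ z * (E z - E (z + e))| ≤ Λ * ‖e‖ * ∫ z in R, |E z| := by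
  have hi1 : Integrable fun z => φ z * E z :=
    (hφ.continuous.mul hE).integrable_of_hasCompactSupport hφc.mul_right
  have hi2 : Integrable fun z => φ z * E (z + e) :=
    (hφ.continuous.mul (by fun_prop)).integrable_of_hasCompactSupport hφc.mul_right
  have htr : ∫ z, φ z * E (z + e) = ∫ z, φ (z - e) * E z := by
    rw [← integral_add_right_eq_self (fun z => φ (z - e) * E z) e]
    simp
  have hi3 : Integrable fun z => φ (z - e) * E z := by
    simpa using hi2.comp_sub_right e
  have h1 : ∫ z, φ z * (E z - E (z + e)) = ∫ z in R, (φ z - φ (z - e)) * E z := by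
    simp only [mul_sub]
    rw [integral_sub hi1 hi2, htr, ← integral_sub hi1 hi3,
      ← setIntegral_eq_integral_of_forall_compl_eq_zero (s := R)]
    · simp only [sub_mul]
    · intro z hz
      simp [hsupp z hz]
  rw [h1, ← integral_const_mul]
  refine (abs_integral_le_integral_abs).trans ?_
  refine integral_mono_of_nonneg (Eventually.of_forall fun z => abs_nonneg _)
    ((hE.abs.continuousOn.integrableOn_compact hR).const_mul _)
    (Eventually.of_forall fun z => ?_)
  simp only [abs_mul]
  refine mul_le_mul_of_nonneg_right ?_ (abs_nonneg _)
  simpa using hφ.norm_sub_le z (z - e)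

/-- The Jacobian determinant is a null Lagrangian: its change under a perturbation is controlled by
the size of the perturbation, not of the derivative of the perturbation. -/
theorem abs_integral_mul_jacobian_sub_le {K Λ : ℝ≥0} {f w : ℝ × ℝ → Plane}
    (hf : LipschitzWith K f) (hw : LipschitzWith (2 * K) w) (hg : LipschitzWith K (f + w))
    {φ Jf Jg : ℝ × ℝ → ℝ} (hφ : LipschitzWith Λ φ) (hφc : HasCompactSupport φ)
    {R : Set (ℝ × ℝ)} (hR : IsCompact R)
    (hsupp : ∀ᶠ s : ℝ in 𝓝[>] 0, ∀ z ∉ R, φ z = 0 ∧ φ (z - (s, 0)) = 0 ∧ φ (z - (0, s)) = 0)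
    (hJf : ∀ᵐ z, φ z ≠ 0 → ∃ f' : ℝ × ℝ →L[ℝ] Plane,
      HasFDerivAt f f' z ∧ wedge (f' (1, 0)) (f' (0, 1)) = Jf z)
    (hJg : ∀ᵐ z, φ z ≠ 0 → ∃ f' : ℝ × ℝ →L[ℝ] Plane,
      HasFDerivAt (f + w) f' z ∧ wedge (f' (1, 0)) (f' (0, 1)) = Jg z) :
    |(∫ z, φ z * Jg z) - ∫ z, φ z * Jf z| ≤ 4 * K * Λ * ∫ z in R, ‖w z‖ := by
  have hlim := ((tendsto_integral_mul_quadArea hg hφ.continuous hφc hJg).sub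
    (tendsto_integral_mul_quadArea hf hφ.continuous hφc hJf)).abs
  have hub : Tendsto (fun s : ℝ => 4 * K * Λ * (∫ z in R, ‖w z‖) +
      s * (2 * Λ * K ^ 2 * volume.real R)) (𝓝[>] 0)
      (𝓝 (4 * K * Λ * (∫ z in R, ‖w z‖) + 0 * (2 * Λ * K ^ 2 * volume.real R))) :=
    ((tendsto_id.mono_left nhdsWithin_le_nhds).mul_const _).const_add _
  rw [zero_mul, add_zero] at hub
  refine le_of_tendsto_of_tendsto hlim hub ?_
  filter_upwards [self_mem_nhdsWithin, hsupp] with s hs hsupp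
  have hs : 0 < s := hs
  have hwn : IntegrableOn (fun z => ‖w z‖) R :=
    hw.continuous.norm.continuousOn.integrableOn_compact hR
  have hint (F : ℝ × ℝ → ℝ) (hF : Continuous F) : Integrable fun z => φ z * F z :=
    (hφ.continuous.mul hF).integrable_of_hasCompactSupport hφc.mul_right
  have hE (e : ℝ × ℝ) : ∫ z in R, |edgeArea f w e z| ≤
      2 * K * ‖e‖ * (∫ z in R, ‖w z‖) + K ^ 2 * ‖e‖ ^ 2 * volume.real R := by
    calc ∫ z in R, |edgeArea f w e z|
        ≤ ∫ z in R, (2 * K * ‖e‖ * ‖w z‖ + K ^ 2 * ‖e‖ ^ 2) := by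
          refine integral_mono_of_nonneg (Eventually.of_forall fun z => abs_nonneg _) ?_
            (Eventually.of_forall fun z => abs_edgeArea_le hf hw e z)
          exact (hwn.const_mul _).add (integrableOn_const hR.measure_ne_top)
      _ = _ := by
          rw [integral_add (hwn.const_mul _) (integrableOn_const hR.measure_ne_top),
            integral_const_mul, setIntegral_const, smul_eq_mul]
          ring
  have hEc (e : ℝ × ℝ) := continuous_edgeArea hf.continuous hw.continuous e
  have h1 := abs_integral_mul_sub_translate_le hφ hφc (hEc (s, 0)) hR (e := (0, s))
    fun z hz => ⟨(hsupp z hz).1, (hsupp z hz).2.2⟩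
  have h2 := abs_integral_mul_sub_translate_le hφ hφc (hEc (0, s)) hR (e := (s, 0))
    fun z hz => ⟨(hsupp z hz).1, (hsupp z hz).2.1⟩
  have hE1 := hE (s, 0)
  have hE2 := hE (0, s)
  rw [norm_horizontal hs.le] at h2 hE1
  rw [norm_vertical hs.le] at h1 hE2
  have heq : (∫ z, φ z * (s⁻¹ ^ 2 * quadArea (f + w) s z)) -
      ∫ z, φ z * (s⁻¹ ^ 2 * quadArea f s z) =
      s⁻¹ ^ 2 * ((∫ z, φ z * (edgeArea f w (s, 0) z - edgeArea f w (s, 0) (z + (0, s)))) -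
        ∫ z, φ z * (edgeArea f w (0, s) z - edgeArea f w (0, s) (z + (s, 0)))) := by
    have hq := continuous_quadArea hf.continuous s
    have hq' := continuous_quadArea hg.continuous s
    have c1 := hEc (s, 0)
    have c2 := hEc (0, s)
    rw [← integral_sub (hint _ (by fun_prop)) (hint _ (by fun_prop)),
      ← integral_sub (hint _ (by fun_prop)) (hint _ (by fun_prop)), ← integral_const_mul]
    congr 1 with z
    linear_combination φ z * s⁻¹ ^ 2 * quadArea_add_sub f w s z
  rw [heq, abs_mul, abs_of_nonneg (by positivity)]
  have h3 : |(∫ z, φ z * (edgeArea f w (s, 0) z - edgeArea f w (s, 0) (z + (0, s)))) -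
        ∫ z, φ z * (edgeArea f w (0, s) z - edgeArea f w (0, s) (z + (s, 0)))| ≤
      Λ * s * (2 * K * s * (∫ z in R, ‖w z‖) + K ^ 2 * s ^ 2 * volume.real R) +
      Λ * s * (2 * K * s * (∫ z in R, ‖w z‖) + K ^ 2 * s ^ 2 * volume.real R) :=
    (abs_sub _ _).trans (add_le_add
      (h1.trans (mul_le_mul_of_nonneg_left hE1 (by positivity)))
      (h2.trans (mul_le_mul_of_nonneg_left hE2 (by positivity))))
  refine (mul_le_mul_of_nonneg_left h3 (by positivity)).trans (le_of_eq ?_)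
  field_simp
  ring

/-! ### Oscillating test functions. -/

/-- The tent function of height `1` and half-width `H` centred at `a`. -/
noncomputable def tent (a H x : ℝ) : ℝ := max 0 (1 - |x - a| / H)

theorem continuous_tent (a H : ℝ) : Continuous (tent a H) := by
  unfold tent; fun_prop

theorem tent_nonneg (a H x : ℝ) : 0 ≤ tent a H x := le_max_left _ _

theorem tent_le_one {H : ℝ} (hH : 0 < H) (a x : ℝ) : tent a H x ≤ 1 :=
  max_le zero_le_one (by have : 0 ≤ |x - a| / H := by positivity
                         linarith)

theorem abs_sub_lt_of_tent_ne_zero {a H x : ℝ} (hH : 0 < H) (h : tent a H x ≠ 0) :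
    |x - a| < H := by
  contrapose! h
  exact max_eq_left (by rw [sub_nonpos, le_div_iff₀ hH]; linarith)

theorem half_le_tent {a H x : ℝ} (hH : 0 < H) (h : |x - a| ≤ H / 2) : 1 / 2 ≤ tent a H x := by
  refine le_max_of_le_right ?_
  have : |x - a| / H ≤ 1 / 2 := by rw [div_le_iff₀ hH]; linarith
  linarith

theorem abs_tent_sub_tent_le {H : ℝ} (hH : 0 < H) (a x y : ℝ) :
    |tent a H x - tent a H y| ≤ |x - y| / H := by
  unfold tent
  rw [max_comm 0, max_comm 0]
  refine (abs_max_sub_max_le_abs _ _ _).trans ?_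
  have h : 1 - |x - a| / H - (1 - |y - a| / H) = (|y - a| - |x - a|) / H := by ring
  rw [h, abs_div, abs_of_pos hH]
  refine div_le_div_of_nonneg_right ?_ hH.le
  have h' := abs_abs_sub_abs_le (y - a) (x - a)
  rwa [sub_sub_sub_cancel_right, abs_sub_comm y x] at h'

theorem hasCompactSupport_tent {H : ℝ} (hH : 0 < H) (a : ℝ) : HasCompactSupport (tent a H) := by
  refine HasCompactSupport.of_support_subset_isCompact (isCompact_Icc (a := a - H) (b := a + H)) ?_
  intro x hx
  have := abs_lt.1 (abs_sub_lt_of_tent_ne_zero hH hx)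
  exact ⟨by linarith, by linarith⟩

theorem half_mul_integral_le_integral_mul_tent {g : ℝ → ℝ} (hg : Continuous g) (hg0 : ∀ x, 0 ≤ g x)
    {H : ℝ} (hH : 0 < H) (a : ℝ) :
    1 / 2 * ∫ x in (a - H / 2)..(a + H / 2), g x ≤ ∫ x, g x * tent a H x := by
  have hi : Integrable fun x => g x * tent a H x :=
    (hg.mul (continuous_tent a H)).integrable_of_hasCompactSupport
      (hasCompactSupport_tent hH a).mul_left
  rw [intervalIntegral.integral_of_le (by linarith), ← integral_const_mul]
  calc ∫ x in Ioc (a - H / 2) (a + H / 2), 1 / 2 * g x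
      ≤ ∫ x in Ioc (a - H / 2) (a + H / 2), g x * tent a H x := by
        refine setIntegral_mono_on ?_ hi.integrableOn measurableSet_Ioc fun x hx => ?_
        · exact ((hg.const_mul _).continuousOn.integrableOn_compact isCompact_Icc).mono_set
            Ioc_subset_Icc_self
        · rw [mul_comm]
          refine mul_le_mul_of_nonneg_left (half_le_tent hH ?_) (hg0 x)
          rw [abs_le]
          constructor <;> linarith [hx.1, hx.2]
    _ ≤ _ := setIntegral_le_integral hi
        (Eventually.of_forall fun x => mul_nonneg (hg0 x) (tent_nonneg _ _ _))

theorem integral_sin_sq_mul_tent_ge {d r : ℝ} (hr : 0 < r) (hrd : 16 * r ≤ d) (a : ℝ) :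
    d / 32 ≤ ∫ x, Real.sin (Real.pi / r * x) ^ 2 * tent a (d / 4) x := by
  refine le_trans ?_ (half_mul_integral_le_integral_mul_tent (by fun_prop)
    (fun x => sq_nonneg _) (by linarith) a)
  have hπ := Real.pi_gt_three
  rw [intervalIntegral.integral_comp_mul_left (fun x => Real.sin x ^ 2) (by positivity),
    integral_sin_sq, smul_eq_mul]
  set u := Real.pi / r * (a - d / 4 / 2)
  set v := Real.pi / r * (a + d / 4 / 2)
  have huv : v - u = Real.pi / r * (d / 4) := by simp only [u, v]; ring
  have h1 (t : ℝ) : |Real.sin t * Real.cos t| ≤ 1 / 2 := by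
    rw [abs_le]
    constructor <;> nlinarith [Real.sin_sq_add_cos_sq t, sq_nonneg (Real.sin t + Real.cos t),
      sq_nonneg (Real.sin t - Real.cos t)]
  have h2 := abs_le.1 (h1 u)
  have h3 := abs_le.1 (h1 v)
  have h4 : (Real.pi / r)⁻¹ * ((Real.pi / r * (d / 4) - 1) / 2) = d / 8 - r / Real.pi / 2 := by
    field_simp
    ring
  have h5 : r / Real.pi ≤ r := div_le_self hr.le (by linarith)
  have h6 : (Real.pi / r)⁻¹ * ((Real.pi / r * (d / 4) - 1) / 2) ≤ (Real.pi / r)⁻¹ *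
      ((Real.sin u * Real.cos u - Real.sin v * Real.cos v + v - u) / 2) := by
    refine mul_le_mul_of_nonneg_left ?_ (by positivity)
    rw [← huv]
    linarith
  linarith

theorem integral_tent_ge {H : ℝ} (hH : 0 < H) (a : ℝ) : H / 2 ≤ ∫ x, tent a H x := by
  have h := half_mul_integral_le_integral_mul_tent (g := fun _ => 1) continuous_const
    (fun _ => zero_le_one) hH a
  simp only [intervalIntegral.integral_const, smul_eq_mul, one_mul, mul_one] at h
  linarith

/-- A test function oscillating with half-period `r` in the first coordinate. -/
noncomputable def sineTent (a b d r : ℝ) (z : ℝ × ℝ) : ℝ :=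
  Real.sin (Real.pi / r * z.1) * tent a (d / 4) z.1 * tent b r z.2

theorem abs_sineTent_le_one {d r : ℝ} (hr : 0 < r) (hd : 0 < d) (a b : ℝ) (z : ℝ × ℝ) :
    |sineTent a b d r z| ≤ 1 := by
  rw [sineTent, abs_mul, abs_mul, abs_of_nonneg (tent_nonneg _ _ _),
    abs_of_nonneg (tent_nonneg _ _ _)]
  refine mul_le_one₀ (mul_le_one₀ (Real.abs_sin_le_one _) (tent_nonneg _ _ _)
    (tent_le_one (by linarith) _ _)) (tent_nonneg _ _ _) (tent_le_one hr _ _)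

theorem sineTent_ne_zero {a b d r : ℝ} (hr : 0 < r) (hd : 0 < d) {z : ℝ × ℝ}
    (h : sineTent a b d r z ≠ 0) : |z.1 - a| < d / 4 ∧ |z.2 - b| < r :=
  ⟨abs_sub_lt_of_tent_ne_zero (by linarith) (right_ne_zero_of_mul (left_ne_zero_of_mul h)),
    abs_sub_lt_of_tent_ne_zero hr (right_ne_zero_of_mul h)⟩

theorem hasCompactSupport_sineTent {d r : ℝ} (hr : 0 < r) (hd : 0 < d) (a b : ℝ) :
    HasCompactSupport (sineTent a b d r) := by
  refine HasCompactSupport.of_support_subset_isCompact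
    ((isCompact_Icc (a := a - d / 4) (b := a + d / 4)).prod
      (isCompact_Icc (a := b - r) (b := b + r))) ?_
  intro z hz
  obtain ⟨h1, h2⟩ := sineTent_ne_zero hr hd hz
  rw [abs_lt] at h1 h2
  exact ⟨⟨by linarith, by linarith⟩, ⟨by linarith, by linarith⟩⟩

theorem abs_mul_mul_sub_le {p q s p' q' s' : ℝ} (hq : |q| ≤ 1) (hq' : |q'| ≤ 1)
    (hp' : |p'| ≤ 1) (hs : |s| ≤ 1) :
    |p * q * s - p' * q' * s'| ≤ |p - p'| + |q - q'| + |s - s'| := by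
  have h : p * q * s - p' * q' * s' = (p - p') * (q * s) + p' * s * (q - q')
      + p' * q' * (s - s') := by ring
  rw [h]
  refine (abs_add_three _ _ _).trans ?_
  simp only [abs_mul]
  have h1 : |q| * |s| ≤ 1 := mul_le_one₀ hq (abs_nonneg _) hs
  have h2 : |p'| * |s| ≤ 1 := mul_le_one₀ hp' (abs_nonneg _) hs
  have h3 : |p'| * |q'| ≤ 1 := mul_le_one₀ hp' (abs_nonneg _) hq'
  gcongr
  · exact mul_le_of_le_one_right (abs_nonneg _) h1
  · exact mul_le_of_le_one_left (abs_nonneg _) h2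
  · exact mul_le_of_le_one_left (abs_nonneg _) h3

theorem lipschitzWith_sineTent {d r : ℝ} (hr : 0 < r) (hrd : 16 * r ≤ d) (a b : ℝ) :
    LipschitzWith (Real.toNNReal (6 / r)) (sineTent a b d r) := by
  refine LipschitzWith.of_dist_le_mul fun z z' => ?_
  rw [Real.coe_toNNReal _ (by positivity), Real.dist_eq, sineTent, sineTent]
  have ht (a H x : ℝ) (hH : 0 < H) : |tent a H x| ≤ 1 := by
    rw [abs_of_nonneg (tent_nonneg _ _ _)]; exact tent_le_one hH _ _
  have hd4 : r ≤ d / 4 := by linarith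
  refine (abs_mul_mul_sub_le (ht _ _ _ (by linarith))
    (ht _ _ _ (by linarith)) (Real.abs_sin_le_one _) (ht _ _ _ hr)).trans ?_
  have h1 : |z.1 - z'.1| ≤ dist z z' := le_max_left _ _
  have h2 : |z.2 - z'.2| ≤ dist z z' := le_max_right _ _
  have hs : |Real.sin (Real.pi / r * z.1) - Real.sin (Real.pi / r * z'.1)| ≤
      4 / r * dist z z' := by
    have hl : |Real.sin (Real.pi / r * z.1) - Real.sin (Real.pi / r * z'.1)| ≤
        |Real.pi / r * z.1 - Real.pi / r * z'.1| := by
      simpa [Real.dist_eq] using Real.lipschitzWith_sin.dist_le_mul (Real.pi / r * z.1)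
        (Real.pi / r * z'.1)
    refine hl.trans ?_
    rw [← mul_sub, abs_mul, abs_of_nonneg (by positivity)]
    gcongr
    exact Real.pi_le_four
  have ht1 : |tent a (d / 4) z.1 - tent a (d / 4) z'.1| ≤ 1 / r * dist z z' := by
    refine (abs_tent_sub_tent_le (by linarith) _ _ _).trans ?_
    rw [one_div_mul_eq_div]
    gcongr
  have ht2 : |tent b r z.2 - tent b r z'.2| ≤ 1 / r * dist z z' := by
    refine (abs_tent_sub_tent_le hr _ _ _).trans ?_
    rw [one_div_mul_eq_div]
    gcongr
  have : 6 / r * dist z z' = 4 / r * dist z z' + 1 / r * dist z z' + 1 / r * dist z z' := by ring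
  linarith

theorem integral_sineTent_mul_sin_ge {d r : ℝ} (hr : 0 < r) (hrd : 16 * r ≤ d) (a b : ℝ) :
    d * r / 64 ≤ ∫ z, sineTent a b d r z * Real.sin (Real.pi / r * z.1) := by
  have h : (fun z : ℝ × ℝ => sineTent a b d r z * Real.sin (Real.pi / r * z.1)) =
      fun z => (Real.sin (Real.pi / r * z.1) ^ 2 * tent a (d / 4) z.1) * tent b r z.2 := by
    ext z; simp only [sineTent]; ring
  rw [h, Measure.volume_eq_prod, integral_prod_mul
    (fun x => Real.sin (Real.pi / r * x) ^ 2 * tent a (d / 4) x)]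
  have := mul_le_mul (integral_sin_sq_mul_tent_ge hr hrd a) (integral_tent_ge hr b)
    (by positivity) ((by linarith : (0 : ℝ) ≤ d / 32).trans (integral_sin_sq_mul_tent_ge hr hrd a))
  linarith

/-! ### Rigidity of almost maximally stretched curves. -/

/-- A curve with almost maximal total stretch, relative to a bound on the stretch at distance `r`,
is close to being translated by a fixed vector under the shift by `r`. -/
theorem integral_norm_shift_sub_le {K : ℝ≥0} {F : ℝ → Plane} (hF : LipschitzWith K F)
    {x₀ d r B ε τ : ℝ} {e : Plane} (he : ‖e‖ = 1) (hr : 0 < r) (hrd : r ≤ d) (hB : 0 ≤ B)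
    (hτ : 0 < τ) (hstretch : ∀ x ∈ Icc x₀ (x₀ + d - r), ‖F (x + r) - F x‖ ≤ B * r)
    (htotal : B * d - ε ≤ inner ℝ (F (x₀ + d) - F x₀) e) :
    ∫ x in x₀..(x₀ + d - r), ‖F (x + r) - F x - (B * r) • e‖ ≤
      r * (τ * d + B * (ε + 2 * K * r) / (2 * τ)) := by
  have hc := hF.continuous
  set G : ℝ → ℝ := fun x => inner ℝ (F x) e with hG
  have hGc : Continuous G := hc.inner continuous_const
  have hGl (x y : ℝ) : |G x - G y| ≤ K * |x - y| := by
    simp only [hG, ← inner_sub_left]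
    refine (abs_real_inner_le_norm _ _).trans ?_
    rw [he, mul_one]
    simpa using hF.norm_sub_le x y
  have hii (a b : ℝ) : IntervalIntegrable G volume a b := hGc.intervalIntegrable a b
  have hle : x₀ ≤ x₀ + d - r := by linarith
  have hpt : ∀ x ∈ Icc x₀ (x₀ + d - r), ‖F (x + r) - F x - (B * r) • e‖ ≤
      τ * r + B / (2 * τ) * (B * r - (G (x + r) - G x)) := by
    intro x hx
    set u := F (x + r) - F x with hu
    have hGu : G (x + r) - G x = inner ℝ u e := by simp only [hG, hu, inner_sub_left]
    have hsq : ‖u - (B * r) • e‖ ^ 2 = ‖u‖ ^ 2 - 2 * (B * r * inner ℝ u e) + (B * r) ^ 2 := by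
      rw [norm_sub_sq_real, real_inner_smul_right, norm_smul, he, mul_one, Real.norm_eq_abs, sq_abs]
    have hus : ‖u‖ ^ 2 ≤ (B * r) ^ 2 := by
      have := hstretch x hx
      gcongr
    rw [hGu]
    set n := ‖u - (B * r) • e‖
    have hn : n ^ 2 ≤ 2 * (B * r) * (B * r - inner ℝ u e) := by nlinarith
    -- The AM-GM weight `τ * r` balances the two terms when the defect `ε` is of order `τ ^ 2 * d`.
    have hamgm : n ≤ τ * r + n ^ 2 / (4 * (τ * r)) := by
      have hτr : 0 < τ * r := by positivity
      rw [← sub_nonneg]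
      have : τ * r + n ^ 2 / (4 * (τ * r)) - n = (n - 2 * (τ * r)) ^ 2 / (4 * (τ * r)) := by
        field_simp; ring
      rw [this]; positivity
    refine hamgm.trans ?_
    have : n ^ 2 / (4 * (τ * r)) ≤ 2 * (B * r) * (B * r - inner ℝ u e) / (4 * (τ * r)) := by
      gcongr
    refine (add_le_add_right this _).trans (le_of_eq ?_)
    field_simp
    ring
  have hshift : Continuous fun x => G (x + r) := by fun_prop
  -- The integral of the increments telescopes to the integrals of `G` over the two end intervals of
  -- length `r`, where `G` is within `K * r` of its endpoint values.
  have hint : ∫ x in x₀..(x₀ + d - r), (G (x + r) - G x) ≥ r * (B * d - ε) - 2 * K * r ^ 2 := by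
    rw [intervalIntegral.integral_sub (hshift.intervalIntegrable _ _) (hii _ _),
      intervalIntegral.integral_comp_add_right G r]
    have h1 : ∫ x in (x₀ + d - r)..(x₀ + d - r + r), G x ≥ r * (G (x₀ + d) - K * r) := by
      have := intervalIntegral.integral_mono_on (a := x₀ + d - r) (b := x₀ + d - r + r)
        (f := fun _ => G (x₀ + d) - K * r) (by linarith)
        intervalIntegrable_const (hii _ _) (fun x hx => by
          have h := (abs_le.1 (hGl x (x₀ + d))).1
          have h' : |x - (x₀ + d)| ≤ r := by rw [abs_le]; constructor <;> linarith [hx.1, hx.2]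
          have := mul_le_mul_of_nonneg_left h' K.coe_nonneg
          linarith)
      rw [intervalIntegral.integral_const, smul_eq_mul] at this
      linarith
    have h2 : ∫ x in x₀..(x₀ + r), G x ≤ r * (G x₀ + K * r) := by
      have := intervalIntegral.integral_mono_on (a := x₀) (b := x₀ + r)
        (g := fun _ => G x₀ + K * r) (by linarith) (hii _ _)
        intervalIntegrable_const (fun x hx => by
          have h := (abs_le.1 (hGl x x₀)).2
          have h' : |x - x₀| ≤ r := by rw [abs_le]; constructor <;> linarith [hx.1, hx.2]
          have := mul_le_mul_of_nonneg_left h' K.coe_nonneg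
          linarith)
      rw [intervalIntegral.integral_const, smul_eq_mul] at this
      linarith
    have h3 := intervalIntegral.integral_interval_sub_interval_comm (hii (x₀ + r) (x₀ + d - r + r))
      (hii x₀ (x₀ + d - r)) (hii (x₀ + r) x₀)
    rw [intervalIntegral.integral_symm x₀ (x₀ + r),
      intervalIntegral.integral_symm (x₀ + d - r) (x₀ + d - r + r)] at h3
    have h4 : B * d - ε ≤ G (x₀ + d) - G x₀ := by
      simpa only [hG, inner_sub_left] using htotal
    nlinarith
  calc ∫ x in x₀..(x₀ + d - r), ‖F (x + r) - F x - (B * r) • e‖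
      ≤ ∫ x in x₀..(x₀ + d - r), (τ * r + B / (2 * τ) * (B * r - (G (x + r) - G x))) :=
        intervalIntegral.integral_mono_on hle
          ((by fun_prop : Continuous _).intervalIntegrable _ _)
          ((by fun_prop : Continuous _).intervalIntegrable _ _) hpt
    _ = τ * r * (d - r) + B / (2 * τ) * (B * r * (d - r) -
          ∫ x in x₀..(x₀ + d - r), (G (x + r) - G x)) := by
        have hGd : Continuous fun x => G (x + r) - G x := by fun_prop
        have hGd' : Continuous fun x => B / (2 * τ) * (B * r - (G (x + r) - G x)) := by fun_prop
        rw [intervalIntegral.integral_add intervalIntegrable_const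
          (hGd'.intervalIntegrable _ _),
          intervalIntegral.integral_const_mul (B / (2 * τ)), intervalIntegral.integral_sub
          intervalIntegrable_const (hGd.intervalIntegrable _ _),
          intervalIntegral.integral_const, intervalIntegral.integral_const, smul_eq_mul,
          smul_eq_mul]
        ring
    _ ≤ τ * r * d + B / (2 * τ) * (r * (ε + 2 * K * r)) := by
        gcongr
        · linarith
        · nlinarith [mul_nonneg hB (sq_nonneg r)]
    _ = _ := by ring

/-! ### Sinusoidal densities and their detection. -/

/-- At almost every point of `S`, `f` is differentiable with Jacobian determinant `ρ`. -/
def JacobianAEOn (f : ℝ × ℝ → Plane) (ρ : ℝ × ℝ → ℝ) (S : Set (ℝ × ℝ)) : Prop :=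
  ∀ᵐ z, z ∈ S → ∃ f' : ℝ × ℝ →L[ℝ] Plane,
    HasFDerivAt f f' z ∧ wedge (f' (1, 0)) (f' (0, 1)) = ρ z

theorem JacobianAEOn.mono {f : ℝ × ℝ → Plane} {ρ : ℝ × ℝ → ℝ} {S T : Set (ℝ × ℝ)}
    (h : JacobianAEOn f ρ T) (hST : S ⊆ T) : JacobianAEOn f ρ S :=
  Eventually.mono h fun _ hz hS => hz (hST hS)

/-- A sinusoidal density of half-period `r` with values in `[1, 1 + c]`. -/
noncomputable def sineDensity (c r x : ℝ) : ℝ := 1 + c * (1 + Real.sin (Real.pi / r * x)) / 2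

theorem continuous_sineDensity (c r : ℝ) : Continuous (sineDensity c r) := by
  unfold sineDensity; fun_prop

theorem sineDensity_mem {c : ℝ} (hc : 0 ≤ c) (r x : ℝ) : sineDensity c r x ∈ Icc 1 (1 + c) := by
  have h1 := Real.neg_one_le_sin (Real.pi / r * x)
  have h2 := Real.sin_le_one (Real.pi / r * x)
  unfold sineDensity
  constructor <;> nlinarith

theorem sineDensity_add_sub {r : ℝ} (hr : r ≠ 0) (c x : ℝ) :
    sineDensity c r (x + r) - sineDensity c r x = -c * Real.sin (Real.pi / r * x) := by
  have h : Real.pi / r * (x + r) = Real.pi / r * x + Real.pi := by field_simp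
  rw [sineDensity, sineDensity, h, Real.sin_add_pi]
  ring

theorem exists_norm_one_inner_eq_norm (u : Plane) : ∃ e : Plane, ‖e‖ = 1 ∧ inner ℝ u e = ‖u‖ := by
  by_cases hu : u = 0
  · exact ⟨EuclideanSpace.single 0 1, by simp, by simp [hu]⟩
  · have hn : ‖u‖ ≠ 0 := norm_ne_zero_iff.2 hu
    refine ⟨‖u‖⁻¹ • u, by rw [norm_smul, norm_inv, norm_norm, inv_mul_cancel₀ hn], ?_⟩
    rw [real_inner_smul_right, real_inner_self_eq_norm_sq]
    field_simp

theorem abs_integral_mul_le_of_support {φ E : ℝ × ℝ → ℝ} {C δ : ℝ} (hC : 0 ≤ C) (hδ : 0 ≤ δ)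
    (hφ : ∀ z, |φ z| ≤ 1) (hE : ∀ z, |E z| ≤ C) (hEc : Continuous E) {R : Set (ℝ × ℝ)}
    (hR : MeasurableSet R) (hφR : ∀ z ∉ R, φ z = 0)
    (hbad : volume {z | z ∈ R ∧ E z ≠ 0} ≤ ENNReal.ofReal δ) :
    |∫ z, φ z * E z| ≤ C * δ := by
  have hm : MeasurableSet {z | z ∈ R ∧ E z ≠ 0} :=
    hR.inter (hEc.measurable (measurableSet_singleton (0 : ℝ)).compl)
  rw [← setIntegral_eq_integral_of_forall_compl_eq_zero (s := {z | z ∈ R ∧ E z ≠ 0})]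
  · rw [← Real.norm_eq_abs]
    refine (norm_setIntegral_le_of_norm_le_const (C := C) (hbad.trans_lt ENNReal.ofReal_lt_top)
      fun z _ => ?_).trans ?_
    · rw [norm_mul]
      have := mul_le_mul (hφ z) (hE z) (abs_nonneg _) zero_le_one
      simpa using this
    · refine mul_le_mul_of_nonneg_left ?_ hC
      exact ENNReal.toReal_le_of_le_ofReal hδ hbad
  · intro z hz
    by_cases hzR : z ∈ R
    · have : E z = 0 := by
        by_contra h
        exact hz ⟨hzR, h⟩
      simp [this]
    · simp [hφR z hzR]

theorem abs_integral_mul_shift_sub_ge {c d r : ℝ} (hc : 0 < c) (hr : 0 < r) (hrd : 16 * r ≤ d)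
    {ρ : ℝ × ℝ → ℝ} (hρc : Continuous ρ) (hρ : ∀ z, ρ z ∈ Icc 1 (1 + c)) (x₀ y₀ : ℝ)
    (hbad : volume {z | z ∈ Icc x₀ (x₀ + d) ×ˢ Icc y₀ (y₀ + 3 * r) ∧
      ρ z - sineDensity c r z.1 ≠ 0} ≤ ENNReal.ofReal (r * d / 1000)) :
    c * d * r / 100 ≤ |(∫ z, sineTent (x₀ + d / 2) (y₀ + 3 * r / 2) d r z * ρ (z + (r, 0))) -
      ∫ z, sineTent (x₀ + d / 2) (y₀ + 3 * r / 2) d r z * ρ z| := by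
  have hd : 0 < d := by linarith
  set φ := sineTent (x₀ + d / 2) (y₀ + 3 * r / 2) d r with hφ
  set E : ℝ × ℝ → ℝ := fun z => ρ z - sineDensity c r z.1 with hE
  have hsc := continuous_sineDensity c r
  have hEc : Continuous E := by fun_prop
  have hEb (z : ℝ × ℝ) : |E z| ≤ c := by
    have h1 := hρ z
    have h2 := sineDensity_mem hc.le r z.1
    rw [abs_le]
    constructor <;> simp only [hE] <;> linarith [h1.1, h1.2, h2.1, h2.2]
  have hφ1 (z : ℝ × ℝ) : |φ z| ≤ 1 := abs_sineTent_le_one hr hd _ _ z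
  have hφc : Continuous φ := (lipschitzWith_sineTent hr hrd _ _).continuous
  have hφs : HasCompactSupport φ := hasCompactSupport_sineTent hr hd _ _
  have hi (F : ℝ × ℝ → ℝ) (hF : Continuous F) : Integrable fun z => φ z * F z :=
    (hφc.mul hF).integrable_of_hasCompactSupport hφs.mul_right
  have hRm : MeasurableSet (Icc x₀ (x₀ + d) ×ˢ Icc y₀ (y₀ + 3 * r)) :=
    measurableSet_Icc.prod measurableSet_Icc
  have hne (z : ℝ × ℝ) (h : φ z ≠ 0) : z.1 ∈ Icc (x₀ + d / 4) (x₀ + 3 * d / 4) ∧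
      z.2 ∈ Icc y₀ (y₀ + 3 * r) := by
    obtain ⟨h1, h2⟩ := sineTent_ne_zero hr hd h
    rw [abs_lt] at h1 h2
    exact ⟨⟨by linarith, by linarith⟩, by linarith, by linarith⟩
  have e1 : |∫ z, φ z * E z| ≤ c * (r * d / 1000) := by
    refine abs_integral_mul_le_of_support hc.le (by positivity) hφ1 hEb hEc hRm ?_ hbad
    intro z hz
    contrapose! hz
    obtain ⟨h1, h2⟩ := hne z hz
    exact ⟨⟨by linarith [h1.1], by linarith [h1.2]⟩, h2⟩
  have e2 : |∫ z, φ z * E (z + (r, 0))| ≤ c * (r * d / 1000) := by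
    -- With the shift on `φ`, whose translated support still lies in the box, the same exceptional
    -- set serves for both error integrals.
    have htr : ∫ z, φ z * E (z + (r, 0)) = ∫ z, φ (z - (r, 0)) * E z := by
      rw [← integral_add_right_eq_self (fun z => φ (z - (r, 0)) * E z) (r, 0)]
      simp
    rw [htr]
    refine abs_integral_mul_le_of_support hc.le (by positivity) (fun z => hφ1 _) hEb hEc hRm ?_ hbad
    intro z hz
    contrapose! hz
    obtain ⟨h1, h2⟩ := hne _ hz
    simp only [Prod.fst_sub, Prod.snd_sub, sub_zero, mem_Icc] at h1 h2
    exact ⟨⟨by linarith [h1.1], by linarith [h1.2]⟩, h2⟩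
  have hS := integral_sineTent_mul_sin_ge hr hrd (x₀ + d / 2) (y₀ + 3 * r / 2)
  rw [← hφ] at hS
  have hsplit : (∫ z, φ z * ρ (z + (r, 0))) - ∫ z, φ z * ρ z =
      -c * (∫ z, φ z * Real.sin (Real.pi / r * z.1)) +
        (∫ z, φ z * E (z + (r, 0))) - ∫ z, φ z * E z := by
    have i1 := hi (fun z => ρ (z + (r, 0))) (by fun_prop)
    have i2 := (hi (fun z => Real.sin (Real.pi / r * z.1)) (by fun_prop)).const_mul (-c)
    have i3 := hi (fun z => E (z + (r, 0))) (by fun_prop)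
    rw [← integral_sub i1 (hi _ hρc), ← integral_const_mul, ← integral_add i2 i3,
      ← integral_sub (by exact i2.add i3) (hi _ hEc)]
    congr 1 with z
    have := sineDensity_add_sub hr.ne' c z.1
    simp only [hE, Prod.fst_add]
    linear_combination φ z * this
  rw [hsplit]
  have a1 := abs_le.1 e1
  have a2 := abs_le.1 e2
  have a3 := mul_le_mul_of_nonneg_left hS hc.le
  have hpos : 0 < c * (r * d) := by positivity
  -- The sine contributes `1 / 64` and the two errors cost `1 / 1000` each, leaving more than `1 /
  -- 100`.
  refine le_trans ?_ (neg_le_abs _)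
  nlinarith [a1.1, a1.2, a2.1, a2.2]

theorem setIntegral_prod_le_of_forall {g : ℝ × ℝ → ℝ} (hg : Continuous g) {a b a' b' C : ℝ}
    (hab : a ≤ b) (hab' : a' ≤ b') (h : ∀ y ∈ Icc a' b', ∫ x in a..b, g (x, y) ≤ C) :
    ∫ z in Icc a b ×ˢ Icc a' b', g z ≤ (b' - a') * C := by
  rw [Measure.volume_eq_prod, ← setIntegral_prod_swap, setIntegral_prod]
  · calc ∫ y in Icc a' b', ∫ x in Icc a b, g (Prod.swap (y, x))
        ≤ ∫ y in Icc a' b', C := by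
          refine setIntegral_mono_on ?_ (integrableOn_const (by simp)) measurableSet_Icc
            fun y hy => ?_
          · refine ContinuousOn.integrableOn_compact isCompact_Icc (Continuous.continuousOn ?_)
            simp only [integral_Icc_eq_integral_Ioc, ← intervalIntegral.integral_of_le hab]
            exact intervalIntegral.continuous_parametric_intervalIntegral_of_continuous'
              (by fun_prop) a b
          · rw [integral_Icc_eq_integral_Ioc, ← intervalIntegral.integral_of_le hab]
            exact h y hy
      _ = _ := by simp [hab']
  · exact (by fun_prop : Continuous fun z : ℝ × ℝ => g z.swap).continuousOn.integrableOn_compact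
      (isCompact_Icc.prod isCompact_Icc)

/-! ### The stretch increment. -/

/-- If `f` has Jacobian close to a sinusoidal density on a thin strip along an `A`-stretched
horizontal segment, then it stretches some shorter horizontal segment by a definite amount more. -/
theorem exists_stretch_gain {K : ℝ≥0} (hK : 1 ≤ (K : ℝ)) {c τ : ℝ} (hc : 0 < c) (hc1 : c ≤ 1)
    (hτ : τ = c / (10 ^ 5 * K ^ 2)) {f : ℝ × ℝ → Plane} (hf : LipschitzWith K f)
    {ρ : ℝ × ℝ → ℝ} (hρc : Continuous ρ) (hρ : ∀ z, ρ z ∈ Icc 1 (1 + c)) {x₀ y₀ y' d r A : ℝ}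
    (hr : 0 < r) (hd : 0 < d) (hrd : 16 * K * r ≤ τ ^ 2 * d)
    (hJ : JacobianAEOn f ρ (Ioo x₀ (x₀ + d) ×ˢ Ioo y₀ (y₀ + 3 * r)))
    (hbad : volume {z | z ∈ Icc x₀ (x₀ + d) ×ˢ Icc y₀ (y₀ + 3 * r) ∧
      ρ z - sineDensity c r z.1 ≠ 0} ≤ ENNReal.ofReal (r * d / 1000))
    (hy' : ∀ y ∈ Icc y₀ (y₀ + 3 * r), 8 * K * |y - y'| ≤ τ ^ 2 * d) (hA : 0 ≤ A) (hAK : A ≤ K)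
    (hstretch : A * d ≤ ‖f (x₀ + d, y') - f (x₀, y')‖) :
    ∃ x ∈ Icc x₀ (x₀ + d - r), ∃ y ∈ Icc y₀ (y₀ + 3 * r),
      (A + τ ^ 2) * r ≤ ‖f (x + r, y) - f (x, y)‖ := by
  by_contra! hcon
  have hK0 : (0 : ℝ) < K := by linarith
  have hτ0 : 0 < τ := by rw [hτ]; positivity
  have hτ1 : τ ≤ 1 := by
    rw [hτ, div_le_one (by positivity)]
    nlinarith
  have hτ2 : τ ^ 2 ≤ 1 := pow_le_one₀ hτ0.le hτ1
  have hrd16 : 16 * r ≤ d := by nlinarith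
  obtain ⟨e, he, hinner⟩ := exists_norm_one_inner_eq_norm (f (x₀ + d, y') - f (x₀, y'))
  set B := A + τ ^ 2 with hBdef
  have hB : 0 ≤ B := by positivity
  set w : ℝ × ℝ → Plane := fun z => f (z + (r, 0)) - f z - (B * r) • e with hw
  have hfs : LipschitzWith K fun z => f (z + (r, 0)) := by
    refine LipschitzWith.of_dist_le_mul fun z z' => ?_
    have h := hf.dist_le_mul (z + (r, 0)) (z' + (r, 0))
    rwa [dist_add_right] at h
  have hwl : LipschitzWith (2 * K) w := by
    rw [two_mul]
    exact LipschitzWith.of_dist_le_mul fun z z' => by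
      simpa [hw] using (hfs.sub hf).dist_le_mul z z'
  have hgw : f + w = fun z => f (z + (r, 0)) - (B * r) • e := by
    ext1 z; simp only [Pi.add_apply, hw]; abel
  have hgl : LipschitzWith K (f + w) := by
    rw [hgw]
    exact LipschitzWith.of_dist_le_mul fun z z' => by simpa using hfs.dist_le_mul z z'
  have hline : ∀ y ∈ Icc y₀ (y₀ + 3 * r),
      ∫ x in x₀..(x₀ + d - r), ‖w (x, y)‖ ≤ 3 * K * r * τ * d := by
    intro y hy
    have hFl : LipschitzWith K fun x => f (x, y) := by
      refine LipschitzWith.of_dist_le_mul fun x x' => ?_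
      simpa [Prod.dist_eq] using hf.dist_le_mul (x, y) (x', y)
    -- `ε` absorbs the excess of `B * d` over `A * d` and the cost of moving both endpoints from
    -- height `y'` to `y`.
    have hF := integral_norm_shift_sub_le hFl (x₀ := x₀) (d := d) (B := B)
      (ε := τ ^ 2 * d + 2 * K * |y - y'|) he hr (by linarith) hB hτ0
      (fun x hx => (hcon x hx y hy).le) (by
        have h1 (x : ℝ) : |inner ℝ (f (x, y) - f (x, y')) e| ≤ K * |y - y'| := by
          refine (abs_real_inner_le_norm _ _).trans ?_
          rw [he, mul_one]
          simpa [Prod.norm_def] using hf.norm_sub_le (x, y) (x, y')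
        have h2 := abs_le.1 (h1 x₀)
        have h3 := abs_le.1 (h1 (x₀ + d))
        simp only [inner_sub_left] at h2 h3 hinner ⊢
        nlinarith [h2.2, h3.1])
    have hwe (x : ℝ) : w (x, y) = f (x + r, y) - f (x, y) - (B * r) • e := by simp [hw]
    simp only [hwe]
    refine hF.trans ?_
    have h4 := hy' y hy
    have h5 : B * (τ ^ 2 * d + 2 * K * |y - y'| + 2 * K * r) / (2 * τ) ≤ 2 * K * τ * d := by
      rw [div_le_iff₀ (by positivity)]
      have h6 : τ ^ 2 * d + 2 * K * |y - y'| + 2 * K * r ≤ 2 * (τ ^ 2 * d) := by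
        have : 0 ≤ τ ^ 2 * d := by positivity
        linarith
      have h7 : B ≤ 2 * K := by linarith
      have := mul_le_mul h7 h6 (by positivity) (by positivity)
      nlinarith
    have h8 : τ * d ≤ K * (τ * d) := le_mul_of_one_le_left (by positivity) hK
    calc _ ≤ r * (τ * d + 2 * K * τ * d) := by gcongr
      _ ≤ _ := by nlinarith
  have hwint := setIntegral_prod_le_of_forall (g := fun z => ‖w z‖) hwl.continuous.norm
    (by linarith : x₀ ≤ x₀ + d - r) (by linarith : y₀ ≤ y₀ + 3 * r) hline
  set φ := sineTent (x₀ + d / 2) (y₀ + 3 * r / 2) d r with hφ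
  have hne (z : ℝ × ℝ) (h : φ z ≠ 0) : (x₀ + d / 4 < z.1 ∧ z.1 < x₀ + 3 * d / 4) ∧
      (y₀ + r / 2 < z.2 ∧ z.2 < y₀ + 5 * r / 2) := by
    obtain ⟨h1, h2⟩ := sineTent_ne_zero hr hd h
    rw [abs_lt] at h1 h2
    exact ⟨⟨by linarith, by linarith⟩, by linarith, by linarith⟩
  have hupper := abs_integral_mul_jacobian_sub_le (φ := φ) (Jf := ρ)
    (Jg := fun z => ρ (z + (r, 0)))
    (R := Icc x₀ (x₀ + d - r) ×ˢ Icc y₀ (y₀ + 3 * r)) hf hwl hgl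
    (lipschitzWith_sineTent hr hrd16 _ _) (hasCompactSupport_sineTent hr hd _ _)
    (isCompact_Icc.prod isCompact_Icc) (by
      -- The strip has height `3 * r` while `φ` occupies only the middle `2 * r`: the margin `r / 2`
      -- leaves room for the small shifts `s`.
      filter_upwards [Ioo_mem_nhdsGT (by linarith : (0 : ℝ) < r / 2)] with s hs z hz
      refine ⟨?_, ?_, ?_⟩
      all_goals
        contrapose! hz
        have := hne _ hz
        try simp only [Prod.fst_sub, Prod.snd_sub, sub_zero] at this
        exact ⟨⟨by linarith [hs.1, hs.2], by linarith [hs.1, hs.2]⟩,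
          by linarith [hs.1, hs.2], by linarith [hs.1, hs.2]⟩)
    (by
      filter_upwards [hJ] with z hz h0
      have := hne z h0
      exact hz ⟨⟨by linarith, by linarith⟩, by linarith, by linarith⟩)
    (by
      have hJs := (measurePreserving_add_right volume ((r, 0) : ℝ × ℝ)).quasiMeasurePreserving.ae hJ
      filter_upwards [hJs] with z hz h0
      have := hne z h0
      obtain ⟨f', hf', hdet⟩ := hz ⟨⟨by simp; linarith, by simp; linarith⟩,
        by simp; linarith, by simp; linarith⟩
      refine ⟨f', ?_, hdet⟩
      rw [hgw]
      exact ((hasFDerivAt_comp_add_right _).2 hf').sub_const _)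
  have hlower := abs_integral_mul_shift_sub_ge hc hr hrd16 hρc hρ x₀ y₀ hbad
  rw [← hφ] at hlower
  rw [Real.coe_toNNReal _ (by positivity)] at hupper
  have h9 : 4 * (K : ℝ) * (6 / r) * ∫ z in Icc x₀ (x₀ + d - r) ×ˢ Icc y₀ (y₀ + 3 * r), ‖w z‖ ≤
      4 * K * (6 / r) * ((y₀ + 3 * r - y₀) * (3 * K * r * τ * d)) := by gcongr
  -- This fixes the choice of `τ`: since `K ^ 2 * τ = c / 10 ^ 5`, the upper bound has coefficient
  -- `216 / 10 ^ 5`, below the `1 / 100` of `hlower`.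
  have h10 : 4 * (K : ℝ) * (6 / r) * ((y₀ + 3 * r - y₀) * (3 * K * r * τ * d)) =
      216 * (c * d * r) / 10 ^ 5 := by
    rw [hτ]; field_simp; ring
  have h11 : 0 < c * d * r := by positivity
  linarith

/-! ### Iteration for a fixed Lipschitz constant. -/

/-- There is a density such that every `K`-Lipschitz map, whose Jacobian is close to that density,
stretches some horizontal segment of a fixed length by a factor at least `A`. -/
def ForcesStretch (K : ℝ≥0) (c A : ℝ) : Prop :=
  ∃ ρ : ℝ × ℝ → ℝ, Continuous ρ ∧ (∀ z, ρ z ∈ Icc 1 (1 + c)) ∧ ∃ δ > 0, ∃ d > 0,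
    ∀ ρ' : ℝ × ℝ → ℝ, Continuous ρ' → (∀ z, ρ' z ∈ Icc 1 (1 + c)) →
      volume {z | z ∈ Icc (0 : ℝ) 1 ×ˢ Icc (0 : ℝ) 1 ∧ ρ' z ≠ ρ z} ≤ ENNReal.ofReal δ →
      ∀ f : ℝ × ℝ → Plane, LipschitzWith K f →
        JacobianAEOn f ρ' (Ioo 0 1 ×ˢ Ioo 0 1) →
        ∃ x y : ℝ, 0 ≤ x ∧ x + d ≤ 1 ∧ 0 ≤ y ∧ y ≤ 1 ∧ A * d ≤ ‖f (x + d, y) - f (x, y)‖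

theorem forcesStretch_zero (K : ℝ≥0) {c : ℝ} (hc : 0 ≤ c) : ForcesStretch K c 0 :=
  ⟨fun _ => 1, continuous_const, fun _ => ⟨le_rfl, by linarith⟩, 1, one_pos, 1, one_pos,
    fun _ _ _ _ _ _ _ => ⟨0, 0, by simp⟩⟩

theorem exists_nat_strip {m : ℕ} (hm : 0 < m) {y : ℝ} (hy0 : 0 ≤ y) (hy1 : y ≤ 1) :
    ∃ j < m, (j / m : ℝ) ≤ y ∧ y ≤ (j + 1) / m := by
  have hm' : (0 : ℝ) < m := by exact_mod_cast hm
  rcases hy1.lt_or_eq with h | rfl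
  · refine ⟨⌊m * y⌋₊, ?_, ?_, ?_⟩
    · rw [Nat.floor_lt (by positivity)]
      nlinarith
    · rw [div_le_iff₀ hm']
      linarith [Nat.floor_le (by positivity : 0 ≤ m * y)]
    · rw [le_div_iff₀ hm']
      linarith [Nat.lt_floor_add_one (m * y)]
  · refine ⟨m - 1, by omega, ?_, ?_⟩
    · rw [div_le_one hm']
      exact_mod_cast Nat.sub_le m 1
    · rw [Nat.cast_sub (by omega)]
      simp [hm'.ne']

/-- A margin `r` on both sides of each strip of height `3 * r` leaves room for a continuous cutoff,
hence the factor `5`. -/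
theorem exists_strip_cutoff (m : ℕ) {r : ℝ} (hr : 0 < r) :
    ∃ ψ : ℝ → ℝ, Continuous ψ ∧ (∀ y, ψ y ∈ Icc (0 : ℝ) 1) ∧
      (∀ j < m, ∀ y ∈ Icc (j / m : ℝ) (j / m + 3 * r), ψ y = 1) ∧
      volume {y | ψ y ≠ 0} ≤ ENNReal.ofReal (5 * m * r) := by
  set C : Set ℝ := ⋃ j ∈ Finset.range m, Icc (j / m : ℝ) (j / m + 3 * r)
  set U : Set ℝ := ⋃ j ∈ Finset.range m, Ioo (j / m - r : ℝ) (j / m + 4 * r)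
  have hC : IsClosed C := isClosed_biUnion_finset fun _ _ => isClosed_Icc
  have hU : IsOpen U := isOpen_biUnion fun _ _ => isOpen_Ioo
  have hCU : C ⊆ U := iUnion₂_mono fun j _ => Icc_subset_Ioo (by linarith) (by linarith)
  obtain ⟨ψ, h0, h1, h01⟩ := exists_continuous_zero_one_of_isClosed hU.isClosed_compl hC
    (disjoint_compl_left_iff_subset.2 hCU)
  refine ⟨ψ, ψ.continuous, h01, fun j hj y hy => h1 ?_, ?_⟩
  · exact mem_biUnion (Finset.mem_coe.2 (Finset.mem_range.2 hj)) hy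
  · have hsub : {y | ψ y ≠ 0} ⊆ U := by
      intro y hy
      by_contra h
      exact hy (h0 h)
    refine (measure_mono hsub).trans ((measure_biUnion_finset_le _ _).trans ?_)
    have h5 (j : ℕ) : (j / m + 4 * r - (j / m - r) : ℝ) = 5 * r := by ring
    simp only [Real.volume_Ioo, h5, Finset.sum_const, Finset.card_range, nsmul_eq_mul]
    rw [← ENNReal.ofReal_natCast, ← ENNReal.ofReal_mul (Nat.cast_nonneg m)]
    exact ENNReal.ofReal_le_ofReal (by linarith)

theorem ForcesStretch.add {K : ℝ≥0} (hK : 1 ≤ (K : ℝ)) {c τ A : ℝ} (hc : 0 < c) (hc1 : c ≤ 1)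
    (hτ : τ = c / (10 ^ 5 * K ^ 2)) (hA : 0 ≤ A) (hAK : A ≤ K) (h : ForcesStretch K c A) :
    ForcesStretch K c (A + τ ^ 2) := by
  obtain ⟨ρ, hρc, hρ, δ, hδ, d, hd, hforce⟩ := h
  have hτ0 : 0 < τ := by rw [hτ]; positivity
  have hτd : 0 < τ ^ 2 * d := by positivity
  -- The spacing `1 / m` is fine enough that every height `y'` is close to some strip; `r` is chosen
  -- afterwards, small in terms of `m`.
  obtain ⟨m, hm⟩ := exists_nat_gt (8 * K / (τ ^ 2 * d))
  have hm0 : (0 : ℝ) < m := lt_of_le_of_lt (by positivity) hm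
  rw [div_lt_iff₀ hτd] at hm
  obtain ⟨r, hr, hr1, hr2, hr3⟩ : ∃ r : ℝ, 0 < r ∧ 16 * K * r ≤ τ ^ 2 * d ∧ 3 * r ≤ 1 / m ∧
      5 * m * r ≤ δ / 2 := by
    have hK0 : (0 : ℝ) < K := by linarith
    obtain ⟨r, hr, hlt⟩ := exists_between
      (by positivity : 0 < min (τ ^ 2 * d / (16 * K)) (min (1 / (m : ℝ) / 3) (δ / 2 / (5 * m))))
    rw [lt_min_iff, lt_min_iff] at hlt
    exact ⟨r, hr, ((lt_div_iff₀' (by positivity)).1 hlt.1).le,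
      ((lt_div_iff₀' (by positivity)).1 hlt.2.1).le, ((lt_div_iff₀' (by positivity)).1 hlt.2.2).le⟩
  obtain ⟨ψ, hψc, hψ, hψ1, hψU⟩ := exists_strip_cutoff m hr
  have hsc := continuous_sineDensity c r
  -- Half of `δ` pays for the strips and the other half for later modifications; `r * d / 1000` is
  -- the error tolerated by `exists_stretch_gain`.
  refine ⟨fun z => (1 - ψ z.2) * ρ z + ψ z.2 * sineDensity c r z.1, by fun_prop, fun z => ?_,
    min (δ / 2) (r * d / 1000), by positivity, r, hr, fun ρ' hρ'c hρ' hclose f hf hJ => ?_⟩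
  · obtain ⟨h1, h2⟩ := hψ z.2
    exact (convex_Icc (1 : ℝ) (1 + c)) (hρ z) (sineDensity_mem hc.le r z.1) (by linarith) h1
      (by ring)
  have hclose' : volume {z | z ∈ Icc (0 : ℝ) 1 ×ˢ Icc (0 : ℝ) 1 ∧ ρ' z ≠ ρ z} ≤
      ENNReal.ofReal δ := by
    have hsub : {z | z ∈ Icc (0 : ℝ) 1 ×ˢ Icc (0 : ℝ) 1 ∧ ρ' z ≠ ρ z} ⊆
        {z | z ∈ Icc (0 : ℝ) 1 ×ˢ Icc (0 : ℝ) 1 ∧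
          ρ' z ≠ (1 - ψ z.2) * ρ z + ψ z.2 * sineDensity c r z.1} ∪
        Icc (0 : ℝ) 1 ×ˢ {y | ψ y ≠ 0} := by
      rintro z ⟨hz, hne⟩
      by_cases hψz : ψ z.2 = 0
      · exact Or.inl ⟨hz, by simpa [hψz] using hne⟩
      · exact Or.inr ⟨hz.1, hψz⟩
    refine (measure_mono hsub).trans ((measure_union_le _ _).trans ?_)
    rw [Measure.volume_eq_prod, Measure.prod_prod, ← Measure.volume_eq_prod, Real.volume_Icc,
      sub_zero, ENNReal.ofReal_one, one_mul]
    have h1 := hclose.trans (ENNReal.ofReal_le_ofReal (min_le_left (δ / 2) (r * d / 1000)))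
    have h2 := hψU.trans (ENNReal.ofReal_le_ofReal hr3)
    refine (add_le_add h1 h2).trans (le_of_eq ?_)
    rw [← ENNReal.ofReal_add (by positivity) (by positivity), add_halves]
  obtain ⟨x₀, y', hx0, hx1, hy0, hy1, hstretch⟩ := hforce ρ' hρ'c hρ' hclose' f hf hJ
  obtain ⟨j, hjm, hj1, hj2⟩ := exists_nat_strip (by exact_mod_cast hm0) hy0 hy1
  have hj0 : (0 : ℝ) ≤ j / m := by positivity
  have hjm1 : (j + 1 : ℝ) / m ≤ 1 := by
    rw [div_le_one hm0]
    exact_mod_cast hjm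
  have hj3 : (j / m + 3 * r : ℝ) ≤ (j + 1) / m := by rw [add_div]; linarith
  obtain ⟨x, hx, y, hy, hxy⟩ := exists_stretch_gain hK hc hc1 hτ hf hρ'c hρ' (x₀ := x₀)
    (y₀ := j / m) (y' := y') hr hd hr1
    (hJ.mono (prod_mono (Ioo_subset_Ioo hx0 hx1) (Ioo_subset_Ioo hj0 (hj3.trans hjm1)))) (by
      refine (measure_mono ?_).trans (hclose.trans (ENNReal.ofReal_le_ofReal (min_le_right _ _)))
      rintro z ⟨hz, hne⟩
      refine ⟨⟨⟨hx0.trans hz.1.1, hz.1.2.trans hx1⟩,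
        ⟨hj0.trans hz.2.1, hz.2.2.trans (hj3.trans hjm1)⟩⟩, ?_⟩
      simpa [hψ1 j hjm z.2 hz.2, sub_eq_zero] using hne)
    (fun y hy => by
      have habs : |y - y'| ≤ 1 / m := by
        rw [add_div] at hj2 hj3
        rw [abs_le]
        constructor <;> linarith [hy.1, hy.2]
      refine (mul_le_mul_of_nonneg_left habs (by positivity)).trans ?_
      rw [mul_one_div, div_le_iff₀ hm0]
      linarith) hA hAK hstretch
  exact ⟨x, y, by linarith [hx.1], by linarith [hx.2], by linarith [hy.1], by linarith [hy.2], hxy⟩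

/-- For each Lipschitz constant, some continuous density close to `1` is not the Jacobian of any
map with that Lipschitz constant. -/
theorem exists_density_not_jacobian_lipschitzWith {K : ℝ≥0} (hK : 1 ≤ (K : ℝ)) {c : ℝ} (hc : 0 < c)
    (hc1 : c ≤ 1) :
    ∃ ρ : ℝ × ℝ → ℝ, Continuous ρ ∧ (∀ z, ρ z ∈ Icc 1 (1 + c)) ∧
      ∀ f : ℝ × ℝ → Plane, LipschitzWith K f → ¬ JacobianAEOn f ρ (Ioo 0 1 ×ˢ Ioo 0 1) := by
  by_contra hcon
  -- Under `hcon` every admissible density is the Jacobian of some `K`-Lipschitz map, so a forced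
  -- stretch cannot exceed `K`.
  have hle (A : ℝ) (h : ForcesStretch K c A) : A ≤ K := by
    by_contra! hA
    obtain ⟨ρ, hρc, hρ, δ, hδ, d, hd, hforce⟩ := h
    refine hcon ⟨ρ, hρc, hρ, fun f hf hJ => ?_⟩
    obtain ⟨x, y, -, -, -, -, hxy⟩ := hforce ρ hρc hρ (by simp) f hf hJ
    have h := hf.norm_sub_le (x + d, y) (x, y)
    simp only [Prod.mk_sub_mk, add_sub_cancel_left, sub_self, norm_horizontal hd.le] at h
    nlinarith
  set τ : ℝ := c / (10 ^ 5 * K ^ 2) with hτ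
  have hτ0 : 0 < τ ^ 2 := by positivity
  have hall (n : ℕ) : ForcesStretch K c (n * τ ^ 2) := by
    induction n with
    | zero => simpa using forcesStretch_zero K hc.le
    | succ n ih =>
      have := ih.add hK hc hc1 hτ (by positivity) (hle _ ih)
      rwa [Nat.cast_succ, add_one_mul]
  obtain ⟨n, hn⟩ := exists_nat_gt (K / τ ^ 2 : ℝ)
  rw [div_lt_iff₀ hτ0] at hn
  exact (hle _ (hall n)).not_gt hn

/-! ### Rescaling and gluing over all Lipschitz constants. -/

theorem ae_comp_add_smul {P : ℝ × ℝ → Prop} (h : ∀ᵐ z, P z) (a : ℝ × ℝ) {b : ℝ} (hb : b ≠ 0) :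
    ∀ᵐ z : ℝ × ℝ, P (a + b • z) := by
  have h1 : ∀ᵐ z : ℝ × ℝ, P (a + z) :=
    (measurePreserving_add_left volume a).quasiMeasurePreserving.ae h
  rw [ae_iff] at h1 ⊢
  have h2 := Measure.addHaar_preimage_smul (volume : Measure (ℝ × ℝ)) hb {z | ¬ P (a + z)}
  rw [h1, mul_zero] at h2
  exact h2

theorem JacobianAEOn.rescale {f : ℝ × ℝ → Plane} {ρ : ℝ × ℝ → ℝ} {S : Set (ℝ × ℝ)}
    (h : JacobianAEOn f ρ S) (a : ℝ × ℝ) {b : ℝ} (hb : b ≠ 0) :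
    JacobianAEOn (fun z => b⁻¹ • f (a + b • z)) (fun z => ρ (a + b • z))
      ((fun z => a + b • z) ⁻¹' S) := by
  filter_upwards [ae_comp_add_smul h a hb] with z hz hzS
  obtain ⟨f', hf', hdet⟩ := hz hzS
  have hin : HasFDerivAt (fun z : ℝ × ℝ => a + b • z) (b • ContinuousLinearMap.id ℝ (ℝ × ℝ)) z :=
    ((hasFDerivAt_id z).const_smul b).const_add a
  refine ⟨f', ?_, hdet⟩
  have := (hf'.comp z hin).const_smul b⁻¹
  have hcancel : b⁻¹ • f'.comp (b • ContinuousLinearMap.id ℝ (ℝ × ℝ)) = f' := by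
    refine ContinuousLinearMap.ext fun v => ?_
    simp [smul_smul, hb]
  rw [hcancel] at this
  exact this

theorem lipschitzWith_rescale {K : ℝ≥0} {f : ℝ × ℝ → Plane} (hf : LipschitzWith K f) (a : ℝ × ℝ)
    {b : ℝ} (hb : 0 < b) : LipschitzWith K fun z => b⁻¹ • f (a + b • z) := by
  refine LipschitzWith.of_dist_le_mul fun z z' => ?_
  have h := hf.dist_le_mul (a + b • z) (a + b • z')
  rw [dist_add_left, dist_smul₀, Real.norm_of_nonneg hb.le] at h
  rw [dist_smul₀, Real.norm_of_nonneg (by positivity), inv_mul_le_iff₀ hb]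
  linarith

/-- A bump function equal to `1` on `[5/8, 7/8]` and vanishing off `[1/2, 1]`. -/
noncomputable def plateau (t : ℝ) : ℝ := max 0 (min 1 (2 - 8 * |t - 3 / 4|))

theorem continuous_plateau : Continuous plateau := by unfold plateau; fun_prop

theorem plateau_mem (t : ℝ) : plateau t ∈ Icc (0 : ℝ) 1 :=
  ⟨le_max_left _ _, max_le zero_le_one (min_le_left _ _)⟩

theorem plateau_eq_one {t : ℝ} (h : t ∈ Icc (5 / 8 : ℝ) (7 / 8)) : plateau t = 1 := by
  have : |t - 3 / 4| ≤ 1 / 8 := by rw [abs_le]; constructor <;> linarith [h.1, h.2]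
  rw [plateau, min_eq_left (by linarith), max_eq_right zero_le_one]

theorem plateau_eq_zero {t : ℝ} (h : 1 / 4 ≤ |t - 3 / 4|) : plateau t = 0 := by
  rw [plateau, max_eq_left]
  exact (min_le_right _ _).trans (by linarith)

theorem plateau_two_pow_mul {x : ℝ} {n k : ℕ} (hx : 2 ^ n * x ∈ Icc (5 / 8 : ℝ) (7 / 8)) :
    plateau (2 ^ k * x) = if k = n then 1 else 0 := by
  have hx0 : 0 < x := by
    have := hx.1
    by_contra! h
    nlinarith [pow_pos (two_pos : (0 : ℝ) < 2) n]
  split_ifs with h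
  · rw [h]; exact plateau_eq_one hx
  · apply plateau_eq_zero
    rcases lt_or_gt_of_ne h with h | h
    · have h2 : (2 : ℝ) ^ (k + 1) ≤ 2 ^ n := pow_le_pow_right₀ one_le_two h
      rw [pow_succ] at h2
      have := mul_le_mul_of_nonneg_right h2 hx0.le
      exact le_trans (by linarith [hx.2]) (neg_le_abs _)
    · have h2 : (2 : ℝ) ^ (n + 1) ≤ 2 ^ k := pow_le_pow_right₀ one_le_two h
      rw [pow_succ] at h2
      have := mul_le_mul_of_nonneg_right h2 hx0.le
      exact le_trans (by linarith [hx.1]) (le_abs_self _)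

/-- Some continuous density close to `1` is not the Jacobian of any Lipschitz map. -/
theorem exists_density_not_jacobian {c : ℝ} (hc : 0 < c) :
    ∃ ρ : ℝ × ℝ → ℝ, Continuous ρ ∧ (∀ z, ρ z ∈ Icc 1 (1 + c)) ∧
      ∀ (K : ℝ≥0) (f : ℝ × ℝ → Plane), LipschitzWith K f →
        ¬ JacobianAEOn f ρ (Ioo 0 1 ×ˢ Ioo 0 1) := by
  -- The amplitudes decay geometrically, so the glued series converges uniformly, and they add up to
  -- `min c 1`.
  have hex (n : ℕ) := exists_density_not_jacobian_lipschitzWith (K := (n + 1 : ℝ≥0)) (by simp)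
    (c := min c 1 / 2 / 2 ^ n) (by positivity) (by
      rw [div_div, div_le_one (by positivity)]
      have : (1 : ℝ) ≤ 2 ^ n := one_le_pow₀ one_le_two
      linarith [min_le_right c 1])
  choose σ hσc hσ hσJ using hex
  -- The square with corner `a n` and side `b n` lies over the part of the dyadic interval where
  -- only the `n`-th plateau is nonzero, and that plateau is `1` there.
  set b : ℕ → ℝ := fun n => (2 ^ n)⁻¹ / 4 with hb
  have hb0 (n : ℕ) : 0 < b n := by positivity
  set a : ℕ → ℝ × ℝ := fun n => (5 / 8 * (2 ^ n)⁻¹, 0) with ha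
  set g : ℕ → ℝ × ℝ → ℝ := fun n z => plateau (2 ^ n * z.1) * (σ n ((b n)⁻¹ • (z - a n)) - 1)
    with hg
  have hg0 (n : ℕ) (z : ℝ × ℝ) : 0 ≤ g n z :=
    mul_nonneg (plateau_mem _).1 (sub_nonneg.2 (hσ n _).1)
  have hgle (n : ℕ) (z : ℝ × ℝ) : g n z ≤ min c 1 / 2 / 2 ^ n := by
    have h1 := hσ n ((b n)⁻¹ • (z - a n))
    have h2 := plateau_mem (2 ^ n * z.1)
    calc g n z ≤ 1 * (min c 1 / 2 / 2 ^ n) :=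
          mul_le_mul h2.2 (by linarith [h1.2]) (by linarith [h1.1]) zero_le_one
      _ = _ := one_mul _
  have hsum : Summable fun n : ℕ => min c 1 / 2 / 2 ^ n := summable_geometric_two' _
  have hgs (z : ℝ × ℝ) : Summable fun n => g n z :=
    Summable.of_nonneg_of_le (fun n => hg0 n z) (fun n => hgle n z) hsum
  have hgc (n : ℕ) : Continuous (g n) := by
    have h1 := continuous_plateau
    have h2 := hσc n
    fun_prop
  refine ⟨fun z => 1 + ∑' n, g n z, continuous_const.add
    (continuous_tsum hgc hsum fun n z => ?_), fun z => ⟨?_, ?_⟩, fun K f hf hJ => ?_⟩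
  · rw [Real.norm_of_nonneg (hg0 n z)]; exact hgle n z
  · have : 0 ≤ ∑' n, g n z := tsum_nonneg fun n => hg0 n z
    linarith
  · have h1 := (hgs z).tsum_le_tsum (fun n => hgle n z) hsum
    rw [tsum_geometric_two'] at h1
    linarith [min_le_left c 1]
  -- Zooming into the `n`-th square preserves both the Lipschitz constant and the Jacobian, so one
  -- `n` with `K ≤ n` excludes `f`.
  obtain ⟨n, hn⟩ := exists_nat_ge K
  have hf' := (lipschitzWith_rescale hf (a n) (hb0 n)).weaken (hn.trans (by simp : (n : ℝ≥0) ≤ n + 1))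
  refine hσJ n _ hf' ?_
  have hp : (0 : ℝ) < 2 ^ n := by positivity
  have hcoord (z : ℝ × ℝ) (hz : z ∈ Ioo (0 : ℝ) 1 ×ˢ Ioo (0 : ℝ) 1) :
      2 ^ n * (a n + b n • z).1 ∈ Icc (5 / 8 : ℝ) (7 / 8) := by
    have h1 : 2 ^ n * (a n + b n • z).1 = 5 / 8 + z.1 / 4 := by
      simp only [ha, hb, Prod.fst_add, Prod.smul_fst, smul_eq_mul]
      field_simp
    rw [h1]
    constructor <;> linarith [hz.1.1, hz.1.2]
  filter_upwards [(hJ.rescale (a n) (hb0 n).ne')] with z hz hzQ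
  have hzn := hcoord z hzQ
  obtain ⟨f', hfd, hdet⟩ := hz (by
    have hpi : ((2 : ℝ) ^ n)⁻¹ ≤ 1 := inv_le_one_of_one_le₀ (one_le_pow₀ one_le_two)
    have hpi0 : (0 : ℝ) < (2 ^ n)⁻¹ := by positivity
    have h2 : (a n + b n • z).2 = (2 ^ n)⁻¹ / 4 * z.2 := by simp [ha, hb]
    have h1 : (a n + b n • z).1 = 5 / 8 * (2 ^ n)⁻¹ + (2 ^ n)⁻¹ / 4 * z.1 := by simp [ha, hb]
    refine ⟨⟨?_, ?_⟩, ?_, ?_⟩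
    · rw [h1]; nlinarith [hzQ.1.1]
    · rw [h1]; nlinarith [hzQ.1.2]
    · rw [h2]; nlinarith [hzQ.2.1]
    · rw [h2]; nlinarith [hzQ.2.2])
  refine ⟨f', hfd, hdet.trans ?_⟩
  rw [tsum_eq_single n]
  · simp only [hg]
    rw [plateau_two_pow_mul hzn]
    simp [smul_smul, inv_mul_cancel₀ (hb0 n).ne']
  · intro k hk
    simp only [hg]
    rw [plateau_two_pow_mul hzn, if_neg hk, zero_mul]

/-! ### Transfer to the Euclidean plane. -/

/-- The identification of `ℝ × ℝ` with the Euclidean plane. -/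
noncomputable def toPlane : ℝ × ℝ →L[ℝ] Plane :=
  LinearMap.toContinuousLinearMap
    { toFun := fun z => !₂[z.1, z.2]
      map_add' := fun z z' => by ext i; fin_cases i <;> simp
      map_smul' := fun t z => by ext i; fin_cases i <;> simp }

@[simp] theorem toPlane_apply_zero (z : ℝ × ℝ) : toPlane z 0 = z.1 := rfl

@[simp] theorem toPlane_apply_one (z : ℝ × ℝ) : toPlane z 1 = z.2 := rfl

theorem measurePreserving_toPlane : MeasurePreserving toPlane := by
  have h1 : MeasurePreserving (MeasurableEquiv.finTwoArrow (α := ℝ)).symm :=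
    (volume_preserving_finTwoArrow ℝ).symm _
  have h2 := EuclideanSpace.volume_preserving_symm_measurableEquiv_toLp (Fin 2)
  exact (h2.symm _).comp h1

theorem norm_toPlane_le (z : ℝ × ℝ) : ‖toPlane z‖ ≤ 2 * ‖z‖ := by
  rw [EuclideanSpace.norm_eq, Fin.sum_univ_two, Real.sqrt_le_left (by positivity)]
  have h1 := norm_fst_le z
  have h2 := norm_snd_le z
  simp only [toPlane_apply_zero, toPlane_apply_one]
  nlinarith [norm_nonneg z.1, norm_nonneg z.2]

theorem det_eq_wedge (f' : Plane →L[ℝ] Plane) :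
    f'.det = wedge (f' (toPlane (1, 0))) (f' (toPlane (0, 1))) := by
  have h0 : toPlane (1, 0) = EuclideanSpace.basisFun (Fin 2) ℝ 0 := by
    ext i; fin_cases i <;> simp
  have h1 : toPlane (0, 1) = EuclideanSpace.basisFun (Fin 2) ℝ 1 := by
    ext i; fin_cases i <;> simp
  rw [ContinuousLinearMap.det, ← LinearMap.det_toMatrix (EuclideanSpace.basisFun (Fin 2) ℝ).toBasis,
    Matrix.det_fin_two, h0, h1]
  simp [LinearMap.toMatrix_apply, wedge]
  ring

theorem toPlane_mem_unitSquare {z : ℝ × ℝ} :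
    toPlane z ∈ unitSquare ↔ z ∈ Icc (0 : ℝ) 1 ×ˢ Icc (0 : ℝ) 1 := by
  simp only [unitSquare, mem_ofPred_eq, Fin.forall_fin_two, toPlane_apply_zero, toPlane_apply_one,
    mem_prod]

/-- The extension of a map on the unit square to `ℝ × ℝ` by projecting to the square. -/
noncomputable def extendSquare (f : Plane → Plane) (z : ℝ × ℝ) : Plane :=
  f (toPlane (projIcc (0 : ℝ) 1 zero_le_one z.1, projIcc (0 : ℝ) 1 zero_le_one z.2))

/-- Projecting to the square is 1-Lipschitz for the sup norm; the factor `2` bounds the Euclidean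
norm by the sup norm. -/
theorem lipschitzWith_extendSquare {K : ℝ≥0} {f : Plane → Plane}
    (hf : LipschitzOnWith K f unitSquare) : LipschitzWith (K * 2) (extendSquare f) := by
  refine LipschitzWith.of_dist_le_mul fun z z' => ?_
  have hproj : LipschitzWith 1 (projIcc (0 : ℝ) 1 zero_le_one) := LipschitzWith.projIcc _
  have hmem (z : ℝ × ℝ) : toPlane (projIcc (0 : ℝ) 1 zero_le_one z.1,
      projIcc (0 : ℝ) 1 zero_le_one z.2) ∈ unitSquare :=
    toPlane_mem_unitSquare.2 ⟨Subtype.coe_prop _, Subtype.coe_prop _⟩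
  refine (hf.dist_le_mul _ (hmem z) _ (hmem z')).trans ?_
  push_cast
  rw [mul_assoc, dist_eq_norm, ← map_sub]
  refine mul_le_mul_of_nonneg_left ((norm_toPlane_le _).trans ?_) K.coe_nonneg
  rw [Prod.norm_def, Prod.dist_eq]
  have h1 := hproj.dist_le_mul z.1 z'.1
  have h2 := hproj.dist_le_mul z.2 z'.2
  simp only [NNReal.coe_one, one_mul, Subtype.dist_eq, Real.dist_eq] at h1 h2
  simp only [Prod.mk_sub_mk, Real.norm_eq_abs, Real.dist_eq]
  exact mul_le_mul_of_nonneg_left (max_le_max h1 h2) zero_le_two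

theorem HasJacobianAEOn.extendSquare {f : Plane → Plane} {ρ : ℝ × ℝ → ℝ}
    (h : HasJacobianAEOn f (fun p => ρ (p 0, p 1)) unitSquare) :
    JacobianAEOn (extendSquare f) ρ (Ioo 0 1 ×ˢ Ioo 0 1) := by
  have hsq : MeasurableSet unitSquare := by
    have : unitSquare = ⋂ i, (fun p : Plane => p i) ⁻¹' Icc 0 1 := by ext; simp [unitSquare]
    rw [this]
    exact MeasurableSet.iInter fun i => (by fun_prop : Measurable fun p : Plane => p i)
      measurableSet_Icc
  have h1 := measurePreserving_toPlane.quasiMeasurePreserving.ae ((ae_restrict_iff' hsq).1 h)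
  filter_upwards [h1] with z hz hzQ
  have hzI : z ∈ Icc (0 : ℝ) 1 ×ˢ Icc (0 : ℝ) 1 :=
    prod_mono Ioo_subset_Icc_self Ioo_subset_Icc_self hzQ
  obtain ⟨f', hf', hdet⟩ := hz (toPlane_mem_unitSquare.2 hzI)
  refine ⟨f'.comp toPlane, ?_, ?_⟩
  · have hnhds : Icc (0 : ℝ) 1 ×ˢ Icc (0 : ℝ) 1 ∈ 𝓝 z :=
      mem_of_superset ((isOpen_Ioo.prod isOpen_Ioo).mem_nhds hzQ)
        (prod_mono Ioo_subset_Icc_self Ioo_subset_Icc_self)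
    have hcomp := (hf'.comp z toPlane.hasFDerivWithinAt
      (fun w hw => toPlane_mem_unitSquare.2 hw : MapsTo toPlane (Icc 0 1 ×ˢ Icc 0 1) _)).hasFDerivAt
      hnhds
    refine hcomp.congr_of_eventuallyEq ?_
    filter_upwards [hnhds] with w hw
    simp [_root_.extendSquare, projIcc_of_mem zero_le_one hw.1, projIcc_of_mem zero_le_one hw.2]
  · rw [ContinuousLinearMap.comp_apply, ContinuousLinearMap.comp_apply, ← det_eq_wedge, hdet]
    rfl

theorem IsBiLipschitzOn.exists_lipschitzOnWith {f : Plane → Plane} {s : Set Plane}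
    (h : IsBiLipschitzOn f s) : ∃ K : ℝ≥0, LipschitzOnWith K f s := by
  obtain ⟨L, hL, h⟩ := h
  refine ⟨L.toNNReal, LipschitzOnWith.of_dist_le_mul fun x hx y hy => ?_⟩
  rw [Real.coe_toNNReal _ (by linarith)]
  exact (h x hx y hy).2

theorem theorem2 (c : ℝ) (hc : 0 < c) :
    ∃ ρ : Plane → ℝ,
      ContinuousOn ρ unitSquare ∧
      MapsTo ρ unitSquare (Icc 1 (1 + c)) ∧
      (¬ ∃ f : Plane → Plane,
        IsBiLipschitzOn f unitSquare ∧ HasJacobianAEOn f ρ unitSquare) ∧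
      (¬ ∃ f : Plane → Plane,
        IsLipschitzHomeoOn f unitSquare ∧ HasJacobianAEOn f ρ unitSquare) := by
  obtain ⟨ρ, hρc, hρ, hJ⟩ := exists_density_not_jacobian hc
  have key (f : Plane → Plane) (hf : ∃ K : ℝ≥0, LipschitzOnWith K f unitSquare)
      (h : HasJacobianAEOn f (fun p => ρ (p 0, p 1)) unitSquare) : False :=
    let ⟨_, hK⟩ := hf
    hJ _ _ (lipschitzWith_extendSquare hK) h.extendSquare
  refine ⟨fun p => ρ (p 0, p 1), Continuous.continuousOn (by fun_prop), fun p _ => hρ _, ?_, ?_⟩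
  · rintro ⟨f, hf, h⟩
    exact key f hf.exists_lipschitzOnWith h
  · rintro ⟨f, hf, h⟩
    exact key f hf.1 h
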